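/- \textbf{Setting.} A \emph{labelled stochastic transition system} (LSTS) $\mathcal T=(S,\Sigma,\kappa,\mathrm{AP},\mathcal L)$ consists of a measurable space $(S,\Sigma)$, a Markov kernel $\kappa$ on it, a finite set $\mathrm{AP}$ and a measurable map $\mathcal L:S\to 2^{\mathrm{AP}}$. For a probability measure $\mu$ on $S$, $\mathbb P^{\mathcal T}_\mu$ denotes the law on infinite paths $S^{\mathbb N}$ of the Markov chain with initial distribution $\mu$ and kernel $\kappa$, and $\Omega_{\mathcal T}(\mu)=\int \kappa(s,\cdot)\,\mu(ds)$. For $B\in\Sigma$, $\mathsf F B$ is the event that the path visits $B$; $B$ is an \emph{attractor} if $\mathbb P^{\mathcal T}_\mu(\mathsf F B)=1$ for every probability measure $\mu$ on $S$. For a path $\rho=s_0s_1\dots$, $\mathsf{Inf}(\rho)$ is the set of $a\in\mathrm{AP}$ with $a\in\mathcal L(s_j)$ for infinitely many $j$. $\mathcal T$ is a \emph{denumerable Markov chain} (DMC) if $S$ is countable and $\Sigma=2^S$. Let $\mathcal T_i=(S_i,\Sigma_i,\kappa_i,\mathrm{AP},\mathcal L_i)$, $i=1,2$, be LSTSs and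 let $\alpha:S_1\to S_2$ be measurable, with push-forward $\alpha_\#$. $\mathcal T_2$ is an \emph{$\alpha$-abstraction} of $\mathcal T_1$ if for every probability measure $\mu$ on $S_1$ the measures $\alpha_\#(\Omega_{\mathcal T_1}(\mu))$ and $\Omega_{\mathcal T_2}(\alpha_\#(\mu))$ have the same null sets, $\alpha(s)=\alpha(s')$ implies $\mathcal L_1(s)=\mathcal L_1(s')$, and $\mathcal L_2(\alpha(s))=\mathcal L_1(s)$ for all $s,s'\in S_1$. The abstraction is \emph{sound} if for every probability measure $\mu$ on $S_1$ and every $B\in\Sigma_2$, $\mathbb P^{\mathcal T_2}_{\alpha_\#(\mu)}(\mathsf F B)=1$ implies $\mathbb P^{\mathcal T_1}_{\mu}(\mathsf F\,\alpha^{-1}(B))=1$. A \emph{deterministic Muller automaton} (DMA) $\mathcal M=(Q,q_0,E,\mathcal F)$ over $\mathrm{AP}$ consists of a finite set $Q$, $q_0\in Q$, a set $E\subseteq Q\times 2^{\mathrm{AP}}\times Q$ such that for every $(q,u)$ there is exactly one $q'$ with $(q,u,q')\in E$, and $\mathcal F\subseteq 2^Q$. The product $\mathcal T\ltimes\mathcal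 M$ is the LSTS over the atomic propositions $Q$ with state space $S\times Q$ (product $\sigma$-algebra, $Q$ discrete), labels $\mathcal L'(s,q)=\{q\}$, and kernel $\kappa'((s,q),A\times\{q'\})=\kappa(s,A)$ if $(q,\mathcal L(s),q')\in E$, and $0$ otherwise. Write $\alpha_{\mathcal M}(s,q)=(\alpha(s),q)$. \textbf{Statement.} Let $\mathcal T_1$ and $\mathcal T_2$ be LSTSs over $\mathrm{AP}$ such that $\mathcal T_2$ is a DMC with a finite attractor and $\mathcal T_2$ is an $\alpha$-abstraction of $\mathcal T_1$. Let $\mathcal M=(Q,q_0,E,\mathcal F)$ be a DMA over $\mathrm{AP}$, and assume that $\mathcal T_2\ltimes\mathcal M$ is a sound $\alpha_{\mathcal M}$-abstraction of $\mathcal T_1\ltimes\mathcal M$. Then for every probability measure $\mu$ on $S_1$, \[ \mathbb P^{\mathcal T_1\ltimes\mathcal M}_{\mu\times\delta_{q_0}}(\mathsf{Inf}\in\mathcal F)=1 \quad\Longleftrightarrow\quad \mathbb P^{\mathcal T_2\ltimes\mathcal M}_{(\alpha_{\mathcal M})_\#(\mu\times\delta_{q_0})}(\mathsf{Inf}\in\mathcal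 F)=1 . \] -/

import Mathlib

open MeasureTheory ProbabilityTheory

/-- A stochastic transition system on the measurable space `S`: a Markov kernel on `S`. -/
structure STS (S : Type*) [MeasurableSpace S] where
  kernel : Kernel S S
  isMarkov : IsMarkovKernel kernel

attribute [instance] STS.isMarkov

namespace STS

variable {S S₁ S₂ : Type*} [MeasurableSpace S] [MeasurableSpace S₁] [MeasurableSpace S₂]

/-- The law on infinite paths `ℕ → S` (with the product `σ`-algebra, which is generated by the
cylinders) of the chain with initial distribution `μ` and transition kernel `T.kernel`: given the
path up to time `n`, the state at time `n + 1` has law `T.kernel (s n)`. -/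
noncomputable def pathMeasure (T : STS S) (μ : Measure S) : Measure (ℕ → S) :=
  Kernel.trajMeasure (X := fun _ => S) μ fun n =>
    T.kernel.comap (fun h : (i : Finset.Iic n) → S => h ⟨n, Finset.mem_Iic.2 le_rfl⟩)
      (measurable_pi_apply _)

/-- The measure transformer `Ω_T(μ)(A) = ∫ κ(s, A) μ(ds)`. -/
noncomputable def transform (T : STS S) (μ : Measure S) : Measure S :=
  μ.bind T.kernel

/-- The event `F B`: the path visits `B` at some time. -/
def eventually (B : Set S) : Set (ℕ → S) := {ρ | ∃ n, ρ n ∈ B}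

/-- `B` is an attractor: it is reached almost surely from every initial distribution. -/
def IsAttractor (T : STS S) (B : Set S) : Prop :=
  MeasurableSet B ∧
    ∀ μ : Measure S, IsProbabilityMeasure μ → T.pathMeasure μ (eventually B) = 1

/-- `T₂` is an `α`-abstraction of `T₁`: for every distribution `μ` on `S₁`, the distributions
`α_#(Ω_{T₁}(μ))` and `Ω_{T₂}(α_#(μ))` have the same null sets. -/
def IsAbstraction (α : S₁ → S₂) (T₁ : STS S₁) (T₂ : STS S₂) : Prop :=
  ∀ μ : Measure S₁, IsProbabilityMeasure μ → ∀ A : Set S₂, MeasurableSet A →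
    ((T₁.transform μ).map α A = 0 ↔ T₂.transform (μ.map α) A = 0)

/-- Soundness: almost-sure reachability of `B` in `T₂` from `α_#(μ)` implies almost-sure
reachability of `α⁻¹(B)` in `T₁` from `μ`, for every measurable `B` and every distribution `μ`. -/
def IsSound (α : S₁ → S₂) (T₁ : STS S₁) (T₂ : STS S₂) : Prop :=
  ∀ μ : Measure S₁, IsProbabilityMeasure μ → ∀ B : Set S₂, MeasurableSet B →
    T₂.pathMeasure (μ.map α) (eventually B) = 1 →
      T₁.pathMeasure μ (eventually (α ⁻¹' B)) = 1

end STS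

/-- A labelled stochastic transition system over the atomic propositions `AP`. For finite `AP`, the
`σ`-algebra on `Set AP` is the discrete one. -/
structure LSTS (S AP : Type*) [MeasurableSpace S] extends STS S where
  label : S → Set AP
  measurable_label : Measurable label

namespace LSTS

variable {S S₁ S₂ AP : Type*} [MeasurableSpace S] [MeasurableSpace S₁] [MeasurableSpace S₂]

/-- The set of atomic propositions that hold infinitely often along the path `ρ`. -/
def inf (T : LSTS S AP) (ρ : ℕ → S) : Set AP := {a | {j | a ∈ T.label (ρ j)}.Infinite}

/-- `T₂` is an `α`-abstraction of `T₁` as a labelled system. -/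
structure IsAbstraction (α : S₁ → S₂) (T₁ : LSTS S₁ AP) (T₂ : LSTS S₂ AP) : Prop where
  toSTS : STS.IsAbstraction α T₁.toSTS T₂.toSTS
  label_eq_of_eq : ∀ s s' : S₁, α s = α s' → T₁.label s = T₁.label s'
  label_map : ∀ s : S₁, T₂.label (α s) = T₁.label s

end LSTS

/-- A deterministic (and complete) Muller automaton over `AP` with locations `Q`; it is used with
`AP` and `Q` finite. -/
structure DMA (AP Q : Type*) where
  init : Q
  edges : Set (Q × Set AP × Q)
  acc : Set (Set Q)
  deterministic : ∀ q u q₁ q₂, (q, u, q₁) ∈ edges → (q, u, q₂) ∈ edges → q₁ = q₂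
  complete : ∀ q u, ∃ q', (q, u, q') ∈ edges

namespace DMA

variable {AP Q : Type*}

/-- The unique location `q'` with an edge `(q, u, q')`. -/
noncomputable def next (M : DMA AP Q) (q : Q) (u : Set AP) : Q := (M.complete q u).choose

theorem next_eq_iff (M : DMA AP Q) (q : Q) (u : Set AP) (q' : Q) :
    M.next q u = q' ↔ (q, u, q') ∈ M.edges :=
  ⟨fun h => h ▸ (M.complete q u).choose_spec,
    fun h => M.deterministic q u _ _ (M.complete q u).choose_spec h⟩

end DMA

namespace LSTS

variable {S AP Q : Type*} [MeasurableSpace S] [Finite AP] [Finite Q] [MeasurableSpace Q]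
  [DiscreteMeasurableSpace Q]

theorem measurable_next (T : LSTS S AP) (M : DMA AP Q) :
    Measurable fun p : S × Q => M.next p.2 (T.label p.1) := by
  have h : Measurable fun x : Q × Set AP => M.next x.1 x.2 := measurable_of_countable _
  exact h.comp (measurable_snd.prodMk (T.measurable_label.comp measurable_fst))

/-- The product `T ⋉ M`: from `(s, q)`, the first component moves according to `T`, the second one
moves to the unique `q'` with `(q, L(s), q') ∈ E`; the state `(s, q)` carries the label `q`. -/
noncomputable def product (T : LSTS S AP) (M : DMA AP Q) : LSTS (S × Q) Q where
  kernel := (T.kernel.comap Prod.fst measurable_fst).prod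
    (Kernel.deterministic (fun p : S × Q => M.next p.2 (T.label p.1)) (T.measurable_next M))
  isMarkov := inferInstance
  label p := {p.2}
  measurable_label := (measurable_of_countable fun q : Q => ({q} : Set Q)).comp measurable_snd

open Classical in
theorem product_kernel_apply (T : LSTS S AP) (M : DMA AP Q) (s : S) (q q' : Q) (A : Set S) :
    (T.product M).kernel (s, q) (A ×ˢ {q'}) =
      if (q, T.label s, q') ∈ M.edges then T.kernel s A else 0 := by
  rw [product, Kernel.prod_apply, Measure.prod_prod, Kernel.comap_apply,
    Kernel.deterministic_apply, Measure.dirac_apply' _ (measurableSet_singleton q')]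
  by_cases h : (q, T.label s, q') ∈ M.edges
  · simp [h, (M.next_eq_iff q (T.label s) q').2 h]
  · simp [h, mt (M.next_eq_iff q (T.label s) q').1 h]

end LSTS

/-! Both probabilities are decided by the transition graph of the countable product `T₂.product M`.
Testing the abstraction on Dirac measures shows that `T₁.product M`, viewed through `Prod.map α id`,
has exactly this graph (`isTransitionGraph_product`).

The finite attractor `B` of `T₂` lifts to the finite attractor `B × Q` of the product. A finite
attractor forces recurrence: there is a set `R` that is reached almost surely, and from any state
reachable from some `r ∈ R`, each state reachable from `r` is reached almost surely
(`exists_recurrent`). These are almost-sure reachability statements, so soundness carries them over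
to `T₁.product M`.

Hence in both systems a run almost surely meets some `r ∈ R` and then visits every state reachable
from `r` infinitely often and no others, so `Inf` is the set of locations of those states.
Acceptance with probability one therefore means that this set is accepting for every `r ∈ R`
reachable from a state charged by the initial law (`limitSet_mem_iff`). This condition involves only
the graph and the push-forward of the initial law, so it is the same for both systems. -/

namespace STS

/-! ### Path measures and the Markov property. -/

variable {S S' : Type*} [MeasurableSpace S] [MeasurableSpace S']

/-- The transition kernel of the chain, as a kernel on histories of length `n + 1`. -/
noncomputable def historyKernel (T : STS S) (n : ℕ) :
    Kernel ((i : Finset.Iic n) → S) S :=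
  T.kernel.comap (fun h : (i : Finset.Iic n) → S => h ⟨n, Finset.mem_Iic.2 le_rfl⟩)
    (measurable_pi_apply _)

instance (T : STS S) (n : ℕ) : IsMarkovKernel (T.historyKernel n) := by
  unfold historyKernel; infer_instance

theorem pathMeasure_eq_trajMeasure (T : STS S) (μ : Measure S) :
    T.pathMeasure μ = Kernel.trajMeasure (X := fun _ => S) μ T.historyKernel := rfl

instance (T : STS S) (μ : Measure S) [IsProbabilityMeasure μ] :
    IsProbabilityMeasure (T.pathMeasure μ) := by
  rw [pathMeasure_eq_trajMeasure]; infer_instance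

/-- The path measure, as a kernel in the initial state. -/
noncomputable def pathKernel (T : STS S) : Kernel S (ℕ → S) :=
  (Kernel.traj (X := fun _ => S) T.historyKernel 0).comap
    (MeasurableEquiv.piUnique (fun _ : Finset.Iic 0 => S)).symm (MeasurableEquiv.measurable _)

instance (T : STS S) : IsMarkovKernel T.pathKernel := by
  unfold pathKernel; infer_instance

theorem pathMeasure_eq_bind (T : STS S) (μ : Measure S) :
    T.pathMeasure μ = μ.bind T.pathKernel := by
  rw [pathMeasure_eq_trajMeasure, Kernel.trajMeasure]
  ext s hs
  rw [Measure.bind_apply hs (Kernel.aemeasurable _), Measure.bind_apply hs (Kernel.aemeasurable _),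
    lintegral_map (Kernel.measurable_coe _ hs) (MeasurableEquiv.measurable _)]
  rfl

theorem pathMeasure_dirac (T : STS S) (s : S) :
    T.pathMeasure (Measure.dirac s) = T.pathKernel s := by
  rw [pathMeasure_eq_bind, Measure.dirac_bind T.pathKernel.measurable]

theorem pathMeasure_apply (T : STS S) (μ : Measure S) {E : Set (ℕ → S)} (hE : MeasurableSet E) :
    T.pathMeasure μ E = ∫⁻ s, T.pathKernel s E ∂μ := by
  rw [pathMeasure_eq_bind, Measure.bind_apply hE (Kernel.aemeasurable _)]

theorem pathKernel_map_zero (T : STS S) (s : S) :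
    (T.pathKernel s).map (fun ρ => ρ 0) = Measure.dirac s := by
  have h := Kernel.traj_map_frestrictLe_apply (X := fun _ => S) (κ := T.historyKernel) 0 0
    ((MeasurableEquiv.piUnique (fun _ : Finset.Iic 0 => S)).symm s)
  have h2 : (fun ρ : ℕ → S => ρ 0) =
      (fun h : (i : Finset.Iic 0) → S => h ⟨0, Finset.mem_Iic.2 le_rfl⟩) ∘
        Preorder.frestrictLe 0 := rfl
  rw [h2, ← Measure.map_map (by fun_prop) (by fun_prop), pathKernel, Kernel.comap_apply, h,
    Kernel.partialTraj_self, Kernel.id_apply, Measure.map_dirac' (by fun_prop)]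
  rfl

theorem ae_pathKernel_zero (T : STS S) (s : S) {C : Set S} (hC : MeasurableSet C) (hs : s ∈ C) :
    ∀ᵐ ρ ∂T.pathKernel s, ρ 0 ∈ C := by
  have h : ∀ᵐ t ∂(T.pathKernel s).map (fun ρ => ρ 0), t ∈ C := by
    rw [pathKernel_map_zero]
    exact (ae_dirac_iff hC).2 hs
  exact ae_of_ae_map (measurable_pi_apply 0).aemeasurable h

theorem pathMeasure_map_zero (T : STS S) (μ : Measure S) :
    (T.pathMeasure μ).map (fun ρ => ρ 0) = μ := by
  rw [pathMeasure_eq_bind, Measure.map_comp _ _ (by fun_prop)]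
  have : T.pathKernel.map (fun ρ => ρ 0) = Kernel.id := by
    ext s : 1
    rw [Kernel.map_apply _ (by fun_prop), pathKernel_map_zero, Kernel.id_apply]
  rw [this, Measure.id_comp]

theorem pathMeasure_map_frestrictLe_prod (T : STS S) (μ : Measure S) [IsProbabilityMeasure μ]
    (n : ℕ) :
    (T.pathMeasure μ).map (fun ρ => (Preorder.frestrictLe (π := fun _ => S) n ρ, ρ (n + 1))) =
      (T.pathMeasure μ).map (Preorder.frestrictLe n) ⊗ₘ T.historyKernel n :=
  Kernel.map_frestrictLe_trajMeasure_compProd_eq_map_trajMeasure.symm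

/-- Every finite set of times lies in an initial segment, so these marginals determine all
finite-dimensional ones; projective limits of finite measures are unique. -/
theorem measure_ext_frestrictLe {ν ν' : Measure (ℕ → S)} [IsFiniteMeasure ν]
    (h : ∀ n, ν.map (Preorder.frestrictLe (π := fun _ => S) n) = ν'.map (Preorder.frestrictLe n)) :
    ν = ν' := by
  have key : IsProjectiveLimit (α := fun _ : ℕ => S) ν (fun I => ν'.map I.restrict) := by
    intro I
    have hr : Measurable (Finset.restrict₂ (π := fun _ : ℕ => S) I.subset_Iic_sup_id) :=
      Finset.measurable_restrict₂ _
    have e : (I.restrict (π := fun _ : ℕ => S)) =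
        Finset.restrict₂ I.subset_Iic_sup_id ∘ Preorder.frestrictLe (I.sup id) := rfl
    change ν.map (I.restrict (π := fun _ : ℕ => S)) = ν'.map (I.restrict (π := fun _ : ℕ => S))
    rw [e, ← Measure.map_map hr (Preorder.measurable_frestrictLe _), h,
      Measure.map_map hr (Preorder.measurable_frestrictLe _)]
  have key' : IsProjectiveLimit (α := fun _ : ℕ => S) ν' (fun I => ν'.map I.restrict) := fun I => rfl
  have : ∀ I : Finset ℕ, IsFiniteMeasure (ν'.map (I.restrict (π := fun _ : ℕ => S))) := by
    intro I
    have := key I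
    dsimp only at this
    rw [← this]
    infer_instance
  exact key.unique key'

/-- A measure on paths with the Markov property is the path measure of its initial law. -/
theorem eq_pathMeasure (T : STS S) (ν : Measure (ℕ → S)) [IsProbabilityMeasure ν]
    (h : ∀ n, ν.map (fun ρ => (Preorder.frestrictLe (π := fun _ => S) n ρ, ρ (n + 1))) =
      ν.map (Preorder.frestrictLe n) ⊗ₘ T.historyKernel n) :
    ν = T.pathMeasure (ν.map fun ρ => ρ 0) := by
  have : IsProbabilityMeasure (ν.map fun ρ => ρ 0) :=
    Measure.isProbabilityMeasure_map (measurable_pi_apply 0).aemeasurable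
  refine measure_ext_frestrictLe fun n => ?_
  induction n with
  | zero =>
    have e : (Preorder.frestrictLe (π := fun _ => S) 0) =
        (fun s (_ : Finset.Iic 0) => s) ∘ fun ρ : ℕ → S => ρ 0 := by
      ext ρ ⟨i, hi⟩
      obtain rfl : i = 0 := by simpa using hi
      rfl
    rw [e, ← Measure.map_map (by fun_prop) (by fun_prop),
      ← Measure.map_map (by fun_prop) (by fun_prop), pathMeasure_map_zero]
  | succ n ih =>
    -- `g` appends the next state to a history, so both marginals are images under `g` of the same
    -- composition-product.
    let g : ((i : Finset.Iic n) → S) × S → (i : Finset.Iic (n + 1)) → S :=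
      fun p i => if hi : i.1 ≤ n then p.1 ⟨i.1, Finset.mem_Iic.2 hi⟩ else p.2
    have hg : Measurable g := by
      refine measurable_pi_lambda _ fun i => ?_
      by_cases hi : i.1 ≤ n
      · simp only [g, hi, dite_true]; fun_prop
      · simp only [g, hi, dite_false]; fun_prop
    have e : (Preorder.frestrictLe (π := fun _ => S) (n + 1)) =
        g ∘ fun ρ => (Preorder.frestrictLe (π := fun _ => S) n ρ, ρ (n + 1)) := by
      ext ρ ⟨i, hi⟩
      by_cases hin : i ≤ n
      · simp [g, hin]
      · obtain rfl : i = n + 1 := by have := Finset.mem_Iic.1 hi; omega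
        simp [g]
    rw [e, ← Measure.map_map hg (by fun_prop), ← Measure.map_map hg (by fun_prop), h,
      pathMeasure_map_frestrictLe_prod, ih]

/-- The image of a chain under a map that is compatible with the kernels, from time `k` on. -/
theorem map_pathMeasure (T : STS S) (T' : STS S') {f : S → S'} (hf : Measurable f)
    (h : ∀ s, (T.kernel s).map f = T'.kernel (f s)) (k : ℕ) (μ : Measure S)
    [IsProbabilityMeasure μ] :
    (T.pathMeasure μ).map (fun ρ n => f (ρ (n + k))) =
      T'.pathMeasure ((T.pathMeasure μ).map fun ρ => f (ρ k)) := by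
  have hF : Measurable fun (ρ : ℕ → S) (n : ℕ) => f (ρ (n + k)) := by fun_prop
  have : IsProbabilityMeasure ((T.pathMeasure μ).map fun (ρ : ℕ → S) n => f (ρ (n + k))) :=
    Measure.isProbabilityMeasure_map hF.aemeasurable
  rw [eq_pathMeasure T' ((T.pathMeasure μ).map fun ρ n => f (ρ (n + k))),
    Measure.map_map (by fun_prop) hF]
  · congr 2
    ext ρ
    simp
  intro n
  -- `φ` drops the first `k` states and applies `f`; the last state is kept, so `h` matches the two
  -- history kernels along `φ`.
  let φ : ((i : Finset.Iic (n + k)) → S) → (i : Finset.Iic n) → S' :=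
    fun x i => f (x ⟨i.1 + k, Finset.mem_Iic.2 (by have := Finset.mem_Iic.1 i.2; omega)⟩)
  have hφ : Measurable φ := by fun_prop
  have e₁ : (fun ρ => (Preorder.frestrictLe (π := fun _ => S') n ρ, ρ (n + 1))) ∘
      (fun (ρ : ℕ → S) n => f (ρ (n + k))) = Prod.map φ f ∘
        fun ρ => (Preorder.frestrictLe (π := fun _ => S) (n + k) ρ, ρ (n + k + 1)) := by
    ext ρ
    · rfl
    · simp [show n + 1 + k = n + k + 1 by omega]
  have e₂ : (Preorder.frestrictLe (π := fun _ => S') n) ∘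
      (fun (ρ : ℕ → S) n => f (ρ (n + k))) =
        φ ∘ Preorder.frestrictLe (π := fun _ => S) (n + k) := rfl
  rw [Measure.map_map (by fun_prop) hF, e₁, ← Measure.map_map (by fun_prop) (by fun_prop),
    pathMeasure_map_frestrictLe_prod, Measure.map_map (by fun_prop) hF, e₂,
    ← Measure.map_map hφ (by fun_prop)]
  have : IsProbabilityMeasure ((T.pathMeasure μ).map
      (Preorder.frestrictLe (π := fun _ => S) (n + k))) :=
    Measure.isProbabilityMeasure_map (by fun_prop)
  generalize (T.pathMeasure μ).map (Preorder.frestrictLe (π := fun _ => S) (n + k)) = m at *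
  have : IsProbabilityMeasure (m.map φ) := Measure.isProbabilityMeasure_map (by fun_prop)
  ext s hs
  rw [Measure.map_apply (by fun_prop) hs, Measure.compProd_apply (by measurability),
    Measure.compProd_apply hs, lintegral_map (Kernel.measurable_kernel_prodMk_left hs) hφ]
  refine lintegral_congr fun x => ?_
  have hx : T'.historyKernel n (φ x) = (T.historyKernel (n + k) x).map f := (h _).symm
  rw [hx, Measure.map_apply hf (measurable_prodMk_left hs)]
  rfl

theorem map_shift_pathMeasure (T : STS S) (k : ℕ) (μ : Measure S) [IsProbabilityMeasure μ] :
    (T.pathMeasure μ).map (fun ρ n => ρ (n + k)) =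
      T.pathMeasure ((T.pathMeasure μ).map fun ρ => ρ k) :=
  map_pathMeasure T T measurable_id (fun _ => Measure.map_id) k μ

theorem map_apply_succ_pathMeasure (T : STS S) (k : ℕ) (μ : Measure S) [IsProbabilityMeasure μ] :
    (T.pathMeasure μ).map (fun ρ => ρ (k + 1)) =
      ((T.pathMeasure μ).map fun ρ => ρ k).bind T.kernel := by
  have e : (fun ρ : ℕ → S => ρ (k + 1)) =
      Prod.snd ∘ fun ρ => (Preorder.frestrictLe (π := fun _ => S) k ρ, ρ (k + 1)) := rfl
  have e' : (fun ρ : ℕ → S => ρ k) =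
      (fun h : (i : Finset.Iic k) → S => h ⟨k, Finset.mem_Iic.2 le_rfl⟩) ∘
        Preorder.frestrictLe (π := fun _ => S) k := rfl
  have : IsProbabilityMeasure ((T.pathMeasure μ).map
      (Preorder.frestrictLe (π := fun _ => S) k)) :=
    Measure.isProbabilityMeasure_map (by fun_prop)
  rw [e, ← Measure.map_map (by fun_prop) (by fun_prop), pathMeasure_map_frestrictLe_prod]
  change Measure.snd _ = _
  rw [Measure.snd_compProd, e', ← Measure.map_map (by fun_prop) (by fun_prop)]
  ext s hs
  rw [Measure.bind_apply hs (Kernel.aemeasurable _), Measure.bind_apply hs (Kernel.aemeasurable _),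
    lintegral_map (Kernel.measurable_coe _ hs) (measurable_pi_apply _)]
  rfl

/-- The first-step decomposition. -/
theorem pathKernel_preimage_shift (T : STS S) (s : S) {E : Set (ℕ → S)} (hE : MeasurableSet E) :
    T.pathKernel s ((fun ρ n => ρ (n + 1)) ⁻¹' E) = ∫⁻ t, T.pathKernel t E ∂T.kernel s := by
  rw [← pathMeasure_dirac, ← Measure.map_apply (by fun_prop) hE, map_shift_pathMeasure,
    map_apply_succ_pathMeasure, pathMeasure_map_zero, Measure.dirac_bind T.kernel.measurable,
    pathMeasure_apply _ _ hE]

/-- The Markov property at time `k`, for almost sure properties. -/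
theorem ae_shift_of_ae (T : STS S) (μ : Measure S) [IsProbabilityMeasure μ] (k : ℕ) {C : Set S}
    (hC : MeasurableSet C) {p : (ℕ → S) → Prop} (hp : MeasurableSet {ρ | p ρ})
    (h : ∀ s ∈ C, ∀ᵐ ρ ∂T.pathKernel s, p ρ) :
    ∀ᵐ ρ ∂T.pathMeasure μ, ρ k ∈ C → p (fun n => ρ (n + k)) := by
  have hm : MeasurableSet {ρ : ℕ → S | ρ 0 ∈ C → p ρ} := by
    have : {ρ : ℕ → S | ρ 0 ∈ C → p ρ} = (Function.eval 0 ⁻¹' C)ᶜ ∪ {ρ | p ρ} := by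
      ext ρ; simp [imp_iff_not_or]
    rw [this]
    exact ((measurable_pi_apply 0) hC).compl.union hp
  -- After the shift the condition concerns time `0`, so it can be checked for each initial state;
  -- outside `C` it is vacuous.
  have key : ∀ᵐ ρ ∂(T.pathMeasure μ).map (fun ρ n => ρ (n + k)), ρ 0 ∈ C → p ρ := by
    rw [map_shift_pathMeasure, ae_iff]
    change T.pathMeasure _ ({ρ : ℕ → S | ρ 0 ∈ C → p ρ}ᶜ) = 0
    rw [pathMeasure_apply _ _ hm.compl]
    refine (lintegral_congr fun s => ?_).trans lintegral_zero
    by_cases hs : s ∈ C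
    · exact ae_iff.1 ((h s hs).mono fun ρ hρ _ => hρ)
    · exact ae_iff.1 ((T.ae_pathKernel_zero s hC.compl hs).mono fun ρ hρ h' => absurd h' hρ)
  have := ae_of_ae_map (by fun_prop : Measurable fun (ρ : ℕ → S) n => ρ (n + k)).aemeasurable key
  simpa using this

theorem measurableSet_eventually {B : Set S} (hB : MeasurableSet B) :
    MeasurableSet (eventually B) := by
  have : eventually B = ⋃ n, (fun ρ : ℕ → S => ρ n) ⁻¹' B := by ext; simp [eventually]
  rw [this]
  exact MeasurableSet.iUnion fun n => (measurable_pi_apply n) hB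

end STS

/-! ### Almost-sure reachability from lower bounds. -/

namespace STS

variable {S : Type*} [MeasurableSpace S]

theorem lintegral_pathKernel_eventually_le (T : STS S) {B : Set S} (hB : MeasurableSet B) (w : S) :
    ∫⁻ t, T.pathKernel t (eventually B) ∂T.kernel w ≤ T.pathKernel w (eventually B) := by
  rw [← pathKernel_preimage_shift _ _ (measurableSet_eventually hB)]
  exact measure_mono fun ρ ⟨n, hn⟩ => ⟨n + 1, hn⟩

/-- If `A` is reached almost surely and `B` is reached with probability at least `c` from `A`, then
`B` is reached with probability at least `c`. -/
theorem le_pathKernel_eventually (T : STS S) {A B : Set S} (hA : MeasurableSet A)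
    (hB : MeasurableSet B) {D : Set S} (hD : ∀ w ∈ D, ∀ᵐ t ∂T.kernel w, t ∈ D)
    (hAD : ∀ w ∈ D, T.pathKernel w (eventually A) = 1) {c : ENNReal}
    (hc : ∀ w ∈ A, w ∈ D → c ≤ T.pathKernel w (eventually B)) {w : S} (hw : w ∈ D) :
    c ≤ T.pathKernel w (eventually B) := by
  let V : ℕ → Set (ℕ → S) := fun n => {ρ | ∃ i < n, ρ i ∈ A}
  have hV : ∀ n, MeasurableSet (V n) := fun n => by
    have : V n = ⋃ i ∈ Finset.range n, (fun ρ : ℕ → S => ρ i) ⁻¹' A := by ext; simp [V]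
    rw [this]
    exact Finset.measurableSet_biUnion _ fun i _ => (measurable_pi_apply i) hA
  -- The inequality `i < n` is strict in `V`, so `V 0` is empty and the induction starts trivially.
  -- Outside `A`, one step of the chain reduces `V (n + 1)` to `V n`.
  have key : ∀ n, ∀ w ∈ D, c * T.pathKernel w (V n) ≤ T.pathKernel w (eventually B) := by
    intro n
    induction n with
    | zero => simp [V]
    | succ n ih =>
      intro w hw
      by_cases hwA : w ∈ A
      · calc c * T.pathKernel w (V (n + 1)) ≤ c * 1 := by gcongr; exact prob_le_one
          _ ≤ _ := by rw [mul_one]; exact hc w hwA hw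
      · have h₁ : T.pathKernel w (V (n + 1)) ≤ ∫⁻ t, T.pathKernel t (V n) ∂T.kernel w := by
          rw [← pathKernel_preimage_shift _ _ (hV n)]
          refine measure_mono_ae ?_
          filter_upwards [T.ae_pathKernel_zero w hA.compl hwA] with ρ hρ
          rintro ⟨_ | i, hi, hiA⟩
          · exact absurd hiA hρ
          · exact ⟨i, by omega, hiA⟩
        calc c * T.pathKernel w (V (n + 1)) ≤ c * ∫⁻ t, T.pathKernel t (V n) ∂T.kernel w := by
              gcongr
          _ = ∫⁻ t, c * T.pathKernel t (V n) ∂T.kernel w :=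
              (lintegral_const_mul _ (Kernel.measurable_coe _ (hV n))).symm
          _ ≤ ∫⁻ t, T.pathKernel t (eventually B) ∂T.kernel w :=
              lintegral_mono_ae ((hD w hw).mono fun t ht => ih t ht)
          _ ≤ _ := T.lintegral_pathKernel_eventually_le hB w
  have hVm : Monotone V := fun m n hmn ρ ⟨i, hi, h⟩ => ⟨i, by omega, h⟩
  have hVU : ⋃ n, V n = eventually A := by
    ext ρ
    simp only [V, Set.mem_iUnion, Set.mem_ofPred_eq, eventually]
    exact ⟨fun ⟨_, i, _, h⟩ => ⟨i, h⟩, fun ⟨i, h⟩ => ⟨i + 1, i, by omega, h⟩⟩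
  calc c = c * T.pathKernel w (⋃ n, V n) := by rw [hVU, hAD w hw, mul_one]
    _ = ⨆ n, c * T.pathKernel w (V n) := by
      rw [hVm.measure_iUnion, ENNReal.mul_iSup]
    _ ≤ _ := iSup_le fun n => key n w hw

/-- If the probability of reaching `B` is bounded away from zero on a closed set `D`, then `B` is
reached almost surely from `D`. -/
theorem pathKernel_eventually_eq_one (T : STS S) {B : Set S} (hB : MeasurableSet B) {D : Set S}
    (hD : ∀ w ∈ D, ∀ᵐ t ∂T.kernel w, t ∈ D) {c : ENNReal} (hc₀ : c ≠ 0)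
    (hc : ∀ w ∈ D, c ≤ T.pathKernel w (eventually B)) {w : S} (hw : w ∈ D) :
    T.pathKernel w (eventually B) = 1 := by
  let V : ℕ → Set (ℕ → S) := fun n => {ρ | ∀ i < n, ρ i ∉ B}
  have hV : ∀ n, MeasurableSet (V n) := fun n => by
    have : V n = ⋂ i ∈ Finset.range n, (fun ρ : ℕ → S => ρ i) ⁻¹' Bᶜ := by ext; simp [V]
    rw [this]
    exact Finset.measurableSet_biInter _ fun i _ => (measurable_pi_apply i) hB.compl
  have hE := measurableSet_eventually hB
  -- Missing `B` forever means avoiding it for `n` steps and then missing it from a state of `D`,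
  -- which has probability at most `1 - c`.
  have key : ∀ n, ∀ w ∈ D,
      T.pathKernel w (eventually B)ᶜ ≤ (1 - c) * T.pathKernel w (V n) := by
    intro n
    induction n with
    | zero =>
      intro w hw
      have : V 0 = Set.univ := by ext; simp [V]
      rw [this, measure_univ, mul_one, prob_compl_eq_one_sub hE]
      exact tsub_le_tsub_left (hc w hw) 1
    | succ n ih =>
      intro w hw
      by_cases hwB : w ∈ B
      · have : T.pathKernel w (eventually B)ᶜ = 0 :=
          ae_iff.1 ((T.ae_pathKernel_zero w hB hwB).mono fun ρ hρ => (⟨0, hρ⟩ : ρ ∈ eventually B))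
        rw [this]
        exact zero_le
      · have h₁ : ∫⁻ t, T.pathKernel t (V n) ∂T.kernel w ≤ T.pathKernel w (V (n + 1)) := by
          rw [← pathKernel_preimage_shift _ _ (hV n)]
          refine measure_mono_ae ?_
          filter_upwards [T.ae_pathKernel_zero w hB.compl hwB] with ρ hρ hi
          rintro (_ | i) hin
          · exact hρ
          · exact hi i (by omega)
        calc T.pathKernel w (eventually B)ᶜ
            ≤ T.pathKernel w ((fun ρ n => ρ (n + 1)) ⁻¹' (eventually B)ᶜ) :=
              measure_mono fun ρ hρ ⟨n, hn⟩ => hρ ⟨n + 1, hn⟩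
          _ = ∫⁻ t, T.pathKernel t (eventually B)ᶜ ∂T.kernel w :=
              pathKernel_preimage_shift _ _ hE.compl
          _ ≤ ∫⁻ t, (1 - c) * T.pathKernel t (V n) ∂T.kernel w :=
              lintegral_mono_ae ((hD w hw).mono fun t ht => ih t ht)
          _ = (1 - c) * ∫⁻ t, T.pathKernel t (V n) ∂T.kernel w :=
              lintegral_const_mul _ (Kernel.measurable_coe _ (hV n))
          _ ≤ _ := by gcongr
  have hVm : Antitone V := fun m n hmn ρ h i hi => h i (by omega)
  have hVI : ⋂ n, V n = (eventually B)ᶜ := by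
    ext ρ
    simp only [V, Set.mem_iInter, Set.mem_ofPred_eq, eventually, Set.mem_compl_iff, not_exists]
    exact ⟨fun h i => h (i + 1) i (by omega), fun h _ i _ => h i⟩
  have hlim := tendsto_measure_iInter_atTop (μ := T.pathKernel w)
    (fun n => (hV n).nullMeasurableSet) hVm ⟨0, measure_ne_top _ _⟩
  rw [hVI] at hlim
  -- In the limit the probability `x` of missing `B` satisfies `x ≤ (1 - c) * x` with `x` finite and
  -- `c ≠ 0`, so `x = 0`.
  have hle : T.pathKernel w (eventually B)ᶜ ≤ (1 - c) * T.pathKernel w (eventually B)ᶜ :=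
    ge_of_tendsto' (ENNReal.Tendsto.const_mul hlim (Or.inr (by simp))) fun n => key n w hw
  have h0 : T.pathKernel w (eventually B)ᶜ = 0 := by
    by_contra hne
    have : (1 - c) * T.pathKernel w (eventually B)ᶜ < 1 * T.pathKernel w (eventually B)ᶜ :=
      ENNReal.mul_lt_mul_left hne (measure_ne_top _ _)
        (ENNReal.sub_lt_self (by simp) (by simp) hc₀)
    rw [one_mul] at this
    exact absurd hle (not_le.2 this)
  exact (prob_compl_eq_zero_iff hE).1 h0

theorem ae_mem_of_ae_ne {X Y : Type*} [MeasurableSpace X] [Countable Y]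
    {ν : Measure X} {β : X → Y} {D : Set Y}
    (h : ∀ y, y ∉ D → ν (β ⁻¹' {y}) = 0) : ∀ᵐ t ∂ν, β t ∈ D := by
  have : ∀ y, ∀ᵐ t ∂ν, β t = y → y ∈ D := fun y => by
    by_cases hy : y ∈ D
    · simp [hy]
    · exact ae_iff.2 (measure_mono_null (fun t ht => by simp_all) (h y hy))
  filter_upwards [ae_all_iff.2 this] with t ht using ht _ rfl

/-! ### Limit sets determined by the transition graph. -/

section Graph

variable {Y : Type*} [Countable Y]

/-- `G` is the graph of the possible transitions of `T`, seen through `β`. -/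
def IsTransitionGraph (T : STS S) (β : S → Y) (G : Y → Y → Prop) : Prop :=
  ∀ s y, T.kernel s (β ⁻¹' {y}) ≠ 0 ↔ G (β s) y

variable {T : STS S} {β : S → Y} {G : Y → Y → Prop}

theorem IsTransitionGraph.ae_kernel_mem (hG : T.IsTransitionGraph β G) {D : Set Y}
    (hD : ∀ x ∈ D, ∀ y, G x y → y ∈ D) {s : S} (hs : β s ∈ D) : ∀ᵐ t ∂T.kernel s, β t ∈ D :=
  ae_mem_of_ae_ne fun y hy => by
    by_contra h
    exact hy (hD _ hs y ((hG s y).1 h))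

variable [MeasurableSpace Y] [DiscreteMeasurableSpace Y]

theorem IsTransitionGraph.ae_path_mem (hG : T.IsTransitionGraph β G) (hβ : Measurable β)
    {D : Set Y} (hD : ∀ x ∈ D, ∀ y, G x y → y ∈ D) (μ : Measure S) [IsProbabilityMeasure μ]
    (hμ : ∀ᵐ s ∂μ, β s ∈ D) : ∀ᵐ ρ ∂T.pathMeasure μ, ∀ n, β (ρ n) ∈ D := by
  refine ae_all_iff.2 fun n => ?_
  have hm : MeasurableSet {s | β s ∈ D} := hβ (MeasurableSet.of_discrete (s := D))
  suffices h : ∀ᵐ s ∂(T.pathMeasure μ).map (fun ρ => ρ n), β s ∈ D from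
    ae_of_ae_map (measurable_pi_apply n).aemeasurable h
  induction n with
  | zero => rwa [pathMeasure_map_zero]
  | succ n ih =>
    rw [map_apply_succ_pathMeasure, ae_iff]
    change Measure.bind _ _ {s | β s ∈ D}ᶜ = 0
    rw [Measure.bind_apply hm.compl (Kernel.aemeasurable _), lintegral_eq_zero_iff
      (Kernel.measurable_coe _ hm.compl)]
    filter_upwards [ih] with s hs using ae_iff.1 (hG.ae_kernel_mem hD hs)

/-- Positivity propagates along edges: an edge `G y z` makes the mass of the fibre of `z` positive
from every state over `y`, so a law charging the fibre of `y` is followed by one charging the fibre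
of `z`. -/
theorem IsTransitionGraph.exists_path_pos (hG : T.IsTransitionGraph β G) (hβ : Measurable β)
    (μ : Measure S) [IsProbabilityMeasure μ] {x y : Y} (hx : μ (β ⁻¹' {x}) ≠ 0)
    (hxy : Relation.ReflTransGen G x y) : ∃ n, T.pathMeasure μ {ρ | β (ρ n) = y} ≠ 0 := by
  have hm : ∀ y, MeasurableSet (β ⁻¹' {y}) := fun y => hβ (measurableSet_singleton y)
  suffices h : ∃ n, (T.pathMeasure μ).map (fun ρ => ρ n) (β ⁻¹' {y}) ≠ 0 by
    obtain ⟨n, hn⟩ := h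
    rw [Measure.map_apply (measurable_pi_apply n) (hm y)] at hn
    exact ⟨n, hn⟩
  induction hxy with
  | refl => exact ⟨0, by rwa [pathMeasure_map_zero]⟩
  | @tail y z _ hyz ih =>
    obtain ⟨n, hn⟩ := ih
    refine ⟨n + 1, fun h => hn ?_⟩
    rw [map_apply_succ_pathMeasure, Measure.bind_apply (hm z) (Kernel.aemeasurable _),
      lintegral_eq_zero_iff (Kernel.measurable_coe _ (hm z))] at h
    refine measure_mono_null (fun s hs => ?_) (ae_iff.1 h)
    exact (hG s z).2 (by rw [Set.mem_preimage.1 hs]; exact hyz)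

/-- The limit set of a sequence: the values taken infinitely often. -/
def limitSet {Q : Type*} (u : ℕ → Q) : Set Q := {q | {j | u j = q}.Infinite}

theorem limitSet_shift {Q : Type*} (u : ℕ → Q) (k : ℕ) :
    limitSet (fun n => u (n + k)) = limitSet u := by
  ext q
  simp only [limitSet, Set.mem_ofPred_eq, ← Nat.frequently_atTop_iff_infinite]
  constructor
  · intro h
    rw [Filter.frequently_atTop] at h ⊢
    intro a
    obtain ⟨b, hb, h⟩ := h a
    exact ⟨b + k, by omega, h⟩
  · intro h
    rw [Filter.frequently_atTop] at h ⊢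
    intro a
    obtain ⟨b, hb, h⟩ := h (a + k)
    exact ⟨b - k, by omega, by rwa [Nat.sub_add_cancel (by omega)]⟩

theorem measurable_limitSet {X Q : Type*} [MeasurableSpace X] [MeasurableSpace Q]
    [DiscreteMeasurableSpace Q] {l : X → Q} (hl : Measurable l) :
    Measurable fun ρ : ℕ → X => limitSet fun n => l (ρ n) := by
  refine measurable_set_iff.2 fun q => measurableSet_setOfPred.1 ?_
  have : {ρ : ℕ → X | q ∈ limitSet fun n => l (ρ n)} =
      ⋂ N, ⋃ n, ⋃ (_ : N ≤ n), (fun ρ : ℕ → X => l (ρ n)) ⁻¹' {q} := by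
    ext ρ
    simp only [limitSet, Set.mem_ofPred_eq, ← Nat.frequently_atTop_iff_infinite,
      Filter.frequently_atTop]
    simp
  rw [this]
  exact MeasurableSet.iInter fun N => MeasurableSet.iUnion fun n => MeasurableSet.iUnion fun _ =>
    (by fun_prop : Measurable fun ρ : ℕ → X => l (ρ n)) MeasurableSet.of_discrete

/-- If from every state that is reachable from `r` every such state is reached almost surely, then
the labels seen infinitely often are those of the states reachable from `r`. -/
theorem IsTransitionGraph.ae_limitSet_eq (hG : T.IsTransitionGraph β G) (hβ : Measurable β)
    {Q : Type*} (l : Y → Q) {r : Y}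
    (hr : ∀ s, Relation.ReflTransGen G r (β s) → ∀ y, Relation.ReflTransGen G r y →
      T.pathKernel s (eventually (β ⁻¹' {y})) = 1) {s : S} (hs : β s = r) :
    ∀ᵐ ρ ∂T.pathKernel s,
      limitSet (fun n => l (β (ρ n))) = l '' {y | Relation.ReflTransGen G r y} := by
  let D : Set Y := {y | Relation.ReflTransGen G r y}
  have hDm : MeasurableSet {s | β s ∈ D} := hβ (MeasurableSet.of_discrete (s := D))
  rw [← pathMeasure_dirac]
  have h₁ : ∀ᵐ ρ ∂T.pathMeasure (Measure.dirac s), ∀ n, β (ρ n) ∈ D :=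
    hG.ae_path_mem hβ (fun x hx y hxy => hx.tail hxy) _
      ((ae_dirac_iff hDm).2 (by rw [hs]; exact Relation.ReflTransGen.refl))
  -- Restarting at every time `n` turns "reached almost surely" into "visited infinitely often";
  -- countability of `Y` allows all `n` and `y` at once.
  have h₂ : ∀ᵐ ρ ∂T.pathMeasure (Measure.dirac s), ∀ n, ∀ y, y ∈ D → β (ρ n) ∈ D →
      ∃ m, β (ρ (m + n)) = y := by
    refine ae_all_iff.2 fun n => ae_all_iff.2 fun y => ?_
    by_cases hy : y ∈ D
    · have hE := measurableSet_eventually (hβ (measurableSet_singleton y))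
      filter_upwards [T.ae_shift_of_ae (Measure.dirac s) n hDm (p := (· ∈ eventually (β ⁻¹' {y}))) hE
        fun t ht => (prob_compl_eq_zero_iff hE).2 (hr t ht y hy)] with ρ hρ _ h using hρ h
    · simp [hy]
  filter_upwards [h₁, h₂] with ρ hρ₁ hρ₂
  ext q
  constructor
  · intro hq
    obtain ⟨j, hj⟩ := hq.nonempty
    exact ⟨_, hρ₁ j, hj⟩
  · rintro ⟨y, hy, rfl⟩
    refine Nat.frequently_atTop_iff_infinite.1 (Filter.frequently_atTop.2 fun n => ?_)
    obtain ⟨m, hm⟩ := hρ₂ n y hy (hρ₁ n)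
    exact ⟨m + n, by omega, congrArg l hm⟩

/-- If a set `R` of recurrent states is reached almost surely, whether the limit set of the labels
lies in `F` almost surely only depends on the transition graph. -/
theorem IsTransitionGraph.limitSet_mem_iff (hG : T.IsTransitionGraph β G) (hβ : Measurable β)
    {Q : Type*} [Finite Q] [MeasurableSpace Q] [DiscreteMeasurableSpace Q] (l : Y → Q)
    (F : Set (Set Q)) {R : Set Y}
    (hR : ∀ s, T.pathKernel s (eventually (β ⁻¹' R)) = 1)
    (hr : ∀ r ∈ R, ∀ s, Relation.ReflTransGen G r (β s) → ∀ y, Relation.ReflTransGen G r y →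
      T.pathKernel s (eventually (β ⁻¹' {y})) = 1)
    (μ : Measure S) [IsProbabilityMeasure μ] :
    T.pathMeasure μ {ρ | limitSet (fun n => l (β (ρ n))) ∈ F} = 1 ↔
      ∀ x, μ (β ⁻¹' {x}) ≠ 0 → ∀ r ∈ R, Relation.ReflTransGen G x r →
        l '' {y | Relation.ReflTransGen G r y} ∈ F := by
  have hlβ : Measurable fun s => l (β s) := (measurable_of_countable l).comp hβ
  have hL : ∀ F : Set (Set Q),
      MeasurableSet {ρ : ℕ → S | limitSet (fun n => l (β (ρ n))) ∈ F} :=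
    fun F => measurable_limitSet hlβ (Set.toFinite F).measurableSet
  have key : ∀ n, ∀ r ∈ R, ∀ᵐ ρ ∂T.pathMeasure μ, β (ρ n) = r →
      limitSet (fun n => l (β (ρ n))) = l '' {y | Relation.ReflTransGen G r y} := by
    intro n r hrR
    filter_upwards [T.ae_shift_of_ae μ n (hβ (measurableSet_singleton r))
      (hL {l '' {y | Relation.ReflTransGen G r y}})
      fun s hs => hG.ae_limitSet_eq hβ l (hr r hrR) hs] with ρ hρ hn
    have := hρ hn
    rwa [limitSet_shift (fun n => l (β (ρ n)))] at this
  have hone : T.pathMeasure μ {ρ | limitSet (fun n => l (β (ρ n))) ∈ F} = 1 ↔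
      ∀ᵐ ρ ∂T.pathMeasure μ, limitSet (fun n => l (β (ρ n))) ∈ F :=
    (prob_compl_eq_zero_iff (hL F)).symm
  rw [hone]
  constructor
  · intro h x hx r hrR hxr
    obtain ⟨n, hn⟩ := hG.exists_path_pos hβ μ hx hxr
    -- An event of positive probability meets the almost-sure ones, so a single path through `r`
    -- reveals that the limit set attached to `r` lies in `F`.
    obtain ⟨ρ, hρ, hρF, hρr⟩ := ((MeasureTheory.frequently_ae_iff.2 hn).and_eventually
      (h.and (key n r hrR))).exists
    rwa [← hρr hρ]
  · intro h
    let D : Set Y := {y | ∃ x, μ (β ⁻¹' {x}) ≠ 0 ∧ Relation.ReflTransGen G x y}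
    have hD : ∀ᵐ ρ ∂T.pathMeasure μ, ∀ n, β (ρ n) ∈ D := by
      refine hG.ae_path_mem hβ (D := D) (fun x ⟨w, hw, hwx⟩ y hxy => ⟨w, hw, hwx.tail hxy⟩) μ
        (ae_mem_of_ae_ne fun y hy => ?_)
      by_contra hne
      exact hy ⟨y, hne, .refl⟩
    have hRm := measurableSet_eventually (hβ (MeasurableSet.of_discrete (s := R)))
    have hReach : ∀ᵐ ρ ∂T.pathMeasure μ, ρ ∈ eventually (β ⁻¹' R) := by
      refine (prob_compl_eq_zero_iff hRm).2 ?_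
      rw [pathMeasure_apply _ _ hRm]
      simp [hR]
    have key' : ∀ᵐ ρ ∂T.pathMeasure μ, ∀ n, ∀ r, r ∈ R → β (ρ n) = r →
        limitSet (fun n => l (β (ρ n))) = l '' {y | Relation.ReflTransGen G r y} := by
      refine ae_all_iff.2 fun n => ae_all_iff.2 fun r => ?_
      by_cases hrR : r ∈ R
      · filter_upwards [key n r hrR] with ρ hρ _ using hρ
      · simp [hrR]
    filter_upwards [hD, hReach, key'] with ρ h₁ ⟨n, hn⟩ h₃
    obtain ⟨x, hx, hxn⟩ := h₁ n
    rw [h₃ n _ hn rfl]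
    exact h x hx _ hn hxn

end Graph

end STS

/-! ### Recurrence in a countable chain with a finite attractor. -/

namespace STS

theorem isTransitionGraph_id {Y : Type*} [MeasurableSpace Y] (T : STS Y) :
    T.IsTransitionGraph id fun x y => T.kernel x {y} ≠ 0 := fun _ _ => Iff.rfl

variable {Y : Type*} [MeasurableSpace Y] [Countable Y] [DiscreteMeasurableSpace Y]

/-- In a countable chain with a finite attractor `A`, a set that is reachable from every state of
`A` in a closed set `D` is reached almost surely from `D`. -/
theorem pathKernel_eventually_eq_one_of_reachable (T : STS Y) {A : Set Y} (hAf : A.Finite)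
    (hA : ∀ y, T.pathKernel y (eventually A) = 1) {D : Set Y}
    (hD : ∀ x ∈ D, ∀ y, T.kernel x {y} ≠ 0 → y ∈ D) {B : Set Y}
    (hB : ∀ a ∈ A, a ∈ D → ∃ b ∈ B, Relation.ReflTransGen (fun x y => T.kernel x {y} ≠ 0) a b)
    {w : Y} (hw : w ∈ D) : T.pathKernel w (eventually B) = 1 := by
  have hD' : ∀ w ∈ D, ∀ᵐ t ∂T.kernel w, t ∈ D := fun w hw =>
    T.isTransitionGraph_id.ae_kernel_mem hD hw
  have hpos : ∀ a ∈ A, a ∈ D → 0 < T.pathKernel a (eventually B) := by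
    intro a ha haD
    obtain ⟨b, hb, hab⟩ := hB a ha haD
    obtain ⟨n, hn⟩ := T.isTransitionGraph_id.exists_path_pos measurable_id (Measure.dirac a)
      (x := a) (by simp) hab
    rw [pathMeasure_dirac] at hn
    exact (pos_iff_ne_zero.2 hn).trans_le (measure_mono fun ρ hρ => ⟨n, by rwa [← hρ] at hb⟩)
  have hfin : (A ∩ D).Finite := hAf.subset Set.inter_subset_left
  -- Finiteness of the attractor gives a uniform positive bound; over an empty `A ∩ D` the infimum
  -- is `⊤`, still nonzero.
  let c : ENNReal := hfin.toFinset.inf fun a => T.pathKernel a (eventually B)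
  have hc₀ : c ≠ 0 := by
    refine (pos_iff_ne_zero.1 ((Finset.lt_inf_iff (by simp)).2 fun a ha => ?_))
    have := hfin.mem_toFinset.1 ha
    exact hpos a this.1 this.2
  refine T.pathKernel_eventually_eq_one .of_discrete hD' hc₀ (fun w hw => ?_) hw
  exact T.le_pathKernel_eventually (A := A) .of_discrete .of_discrete hD' (fun w _ => hA w)
    (fun a ha haD => Finset.inf_le (hfin.mem_toFinset.2 ⟨ha, haD⟩)) hw

/-- A countable chain with a finite attractor almost surely reaches a set of recurrent states. -/
theorem exists_recurrent (T : STS Y) {A : Set Y} (hAf : A.Finite)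
    (hA : ∀ y, T.pathKernel y (eventually A) = 1) :
    ∃ R : Set Y, (∀ y, T.pathKernel y (eventually R) = 1) ∧
      ∀ r ∈ R, ∀ x, Relation.ReflTransGen (fun x y => T.kernel x {y} ≠ 0) r x →
        ∀ y, Relation.ReflTransGen (fun x y => T.kernel x {y} ≠ 0) r y →
          T.pathKernel x (eventually {y}) = 1 := by
  let Reach : Y → Y → Prop := Relation.ReflTransGen fun x y => T.kernel x {y} ≠ 0
  -- Only returns from attractor states are required: every other state reachable from `r` almost
  -- surely meets `A` again.
  refine ⟨{r | r ∈ A ∧ ∀ a ∈ A, Reach r a → Reach a r}, fun y => ?_, ?_⟩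
  · refine T.pathKernel_eventually_eq_one_of_reachable hAf hA (D := Set.univ) (by simp)
      (fun a ha _ => ?_) (Set.mem_univ y)
    -- Choose `r` reaching the fewest attractor states. Any `x ∈ A` reachable from `r` reaches a
    -- subset of them, hence all of them by minimality, including `r`.
    obtain ⟨r, ⟨hrA, har⟩, hmin⟩ := Set.exists_min_image {r | r ∈ A ∧ Reach a r}
      (fun r => {x | x ∈ A ∧ Reach r x}.ncard) (hAf.subset fun x hx => hx.1) ⟨a, ha, .refl⟩
    refine ⟨r, ⟨hrA, fun x hx hrx => ?_⟩, har⟩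
    have hsub : {z | z ∈ A ∧ Reach x z} ⊆ {z | z ∈ A ∧ Reach r z} :=
      fun z hz => ⟨hz.1, hrx.trans hz.2⟩
    have heq := Set.eq_of_subset_of_ncard_le hsub (hmin x ⟨hx, har.trans hrx⟩)
      (hAf.subset fun x hx => hx.1)
    exact (heq.ge (⟨hrA, .refl⟩ : r ∈ {z | z ∈ A ∧ Reach r z})).2
  · rintro r ⟨_, hr⟩ x hx y hy
    refine T.pathKernel_eventually_eq_one_of_reachable hAf hA (D := {z | Reach r z})
      (B := {y})
      (fun z hz z' hzz' => hz.tail hzz') (fun a ha har => ⟨y, rfl, ?_⟩) hx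
    exact (hr a ha har).trans hy

end STS

/-! ### Products with the automaton. -/

namespace LSTS

variable {S S₁ S₂ AP Q : Type*} [MeasurableSpace S] [MeasurableSpace S₁] [MeasurableSpace S₂]
  [Finite AP] [Finite Q] [MeasurableSpace Q] [DiscreteMeasurableSpace Q]

theorem inf_product (T : LSTS S AP) (M : DMA AP Q) (ρ : ℕ → S × Q) :
    (T.product M).inf ρ = STS.limitSet fun n => (ρ n).2 := by
  ext q
  simp [inf, STS.limitSet, product, eq_comm]

theorem product_kernel_map_fst (T : LSTS S AP) (M : DMA AP Q) (p : S × Q) :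
    ((T.product M).kernel p).map Prod.fst = T.kernel p.1 := by
  rw [product, Kernel.prod_apply]
  change Measure.fst _ = _
  rw [Measure.fst_prod, Kernel.comap_apply]

/-- The first component of the product is itself a chain of `T`; this lifts attractors to the
product. -/
theorem pathKernel_product_eventually (T : LSTS S AP) (M : DMA AP Q) {B : Set S}
    (hB : MeasurableSet B) (p : S × Q) :
    (T.product M).pathKernel p (STS.eventually (Prod.fst ⁻¹' B)) =
      T.pathKernel p.1 (STS.eventually B) := by
  have h := STS.map_pathMeasure (T.product M).toSTS T.toSTS measurable_fst
    (T.product_kernel_map_fst M) 0 (Measure.dirac p)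
  have h₀ : ((T.product M).pathMeasure (Measure.dirac p)).map (fun ρ => (ρ 0).1) =
      Measure.dirac p.1 := by
    have e : (fun ρ : ℕ → S × Q => (ρ 0).1) = Prod.fst ∘ fun ρ => ρ 0 := rfl
    rw [e, ← Measure.map_map (by fun_prop) (by fun_prop), STS.pathMeasure_map_zero,
      Measure.map_dirac' measurable_fst]
  rw [h₀, STS.pathMeasure_dirac, STS.pathMeasure_dirac] at h
  rw [← h, Measure.map_apply (by fun_prop) (STS.measurableSet_eventually hB)]
  rfl

/-- The abstraction, tested on a Dirac measure and a singleton, compares the first components;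
equality of labels makes the automaton moves coincide. -/
theorem IsAbstraction.isTransitionGraph_product [Countable S₂] [DiscreteMeasurableSpace S₂]
    {T₁ : LSTS S₁ AP} {T₂ : LSTS S₂ AP} {α : S₁ → S₂} (h : IsAbstraction α T₁ T₂)
    (hα : Measurable α) (M : DMA AP Q) :
    (T₁.product M).toSTS.IsTransitionGraph (Prod.map α id)
      fun x y => (T₂.product M).kernel x {y} ≠ 0 := by
  rintro ⟨s, q⟩ ⟨y, q'⟩
  have e₁ : Prod.map α id ⁻¹' {(y, q')} = (α ⁻¹' {y}) ×ˢ ({q'} : Set Q) := by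
    ext ⟨t, p⟩; simp
  have e₂ : ({(y, q')} : Set (S₂ × Q)) = {y} ×ˢ {q'} := by simp
  have h₁ := h.toSTS (Measure.dirac s) inferInstance {y} .of_discrete
  rw [STS.transform, STS.transform, Measure.map_dirac' hα,
    Measure.dirac_bind T₁.kernel.measurable, Measure.dirac_bind T₂.kernel.measurable,
    Measure.map_apply hα .of_discrete] at h₁
  beta_reduce
  rw [e₁, e₂, Prod.map_apply, product_kernel_apply, product_kernel_apply, h.label_map, id]
  split_ifs
  · exact not_congr h₁
  · rfl

end LSTS

theorem mainTheorem8 {S₁ S₂ AP Q : Type*}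
    [MeasurableSpace S₁]
    [MeasurableSpace S₂] [Countable S₂] [DiscreteMeasurableSpace S₂]
    [Finite AP]
    [Finite Q] [MeasurableSpace Q] [DiscreteMeasurableSpace Q]
    (T₁ : LSTS S₁ AP) (T₂ : LSTS S₂ AP) (M : DMA AP Q)
    (α : S₁ → S₂) (hα : Measurable α)
    (hattr : ∃ B : Set S₂, B.Finite ∧ T₂.toSTS.IsAttractor B)
    (habs : LSTS.IsAbstraction α T₁ T₂)
    (hsound : STS.IsSound (Prod.map α id) (T₁.product M).toSTS (T₂.product M).toSTS)
    (μ : Measure S₁) [IsProbabilityMeasure μ] :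
    (T₁.product M).pathMeasure (μ.prod (Measure.dirac M.init))
        {ρ | (T₁.product M).inf ρ ∈ M.acc} = 1 ↔
      (T₂.product M).pathMeasure ((μ.prod (Measure.dirac M.init)).map (Prod.map α id))
        {ρ | (T₂.product M).inf ρ ∈ M.acc} = 1 := by
  obtain ⟨B, hBf, hB⟩ := hattr
  have hβ : Measurable (Prod.map α (id : Q → Q)) := hα.prodMap measurable_id
  have hA : ∀ p, (T₂.product M).pathKernel p (STS.eventually (Prod.fst ⁻¹' B)) = 1 := fun p => by
    rw [LSTS.pathKernel_product_eventually _ _ hB.1, ← STS.pathMeasure_dirac]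
    exact hB.2 _ inferInstance
  have hAf : (Prod.fst ⁻¹' B : Set (S₂ × Q)).Finite := by
    rw [← Set.prod_univ]
    exact hBf.prod Set.finite_univ
  obtain ⟨R, hR, hr⟩ := (T₂.product M).exists_recurrent hAf hA
  have transfer : ∀ (p : S₁ × Q) (C : Set (S₂ × Q)),
      (T₂.product M).pathKernel (Prod.map α id p) (STS.eventually C) = 1 →
        (T₁.product M).pathKernel p (STS.eventually (Prod.map α id ⁻¹' C)) = 1 := by
    intro p C hC
    rw [← STS.pathMeasure_dirac] at hC ⊢
    rw [← Measure.map_dirac' hβ] at hC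
    exact hsound _ inferInstance C .of_discrete hC
  -- `R` and the graph come from `T₂.product M`; `transfer` supplies the recurrence hypotheses in
  -- `T₁.product M`.
  have h₁ := (habs.isTransitionGraph_product hα M).limitSet_mem_iff hβ Prod.snd M.acc
    (fun p => transfer p R (hR _)) (fun r hrR p hp y hy => transfer p {y} (hr r hrR _ hp y hy))
    (μ.prod (Measure.dirac M.init))
  have : IsProbabilityMeasure ((μ.prod (Measure.dirac M.init)).map (Prod.map α id)) :=
    Measure.isProbabilityMeasure_map hβ.aemeasurable
  have h₂ := (T₂.product M).isTransitionGraph_id.limitSet_mem_iff measurable_id Prod.snd M.acc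
    hR hr ((μ.prod (Measure.dirac M.init)).map (Prod.map α id))
  simp only [LSTS.inf_product]
  refine h₁.trans (Iff.trans ?_ h₂.symm)
  -- The push-forward charges `x` exactly when the initial law charges the fibre over `x`, so the
  -- two criteria coincide.
  simp only [Set.preimage_id, Measure.map_apply hβ (measurableSet_singleton _)]
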